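/- Let $F_0=0$, $F_1=1$, $F_n=F_{n-1}+F_{n-2}$ be the Fibonacci numbers. For positive integers $a,b,c$ let $n_3(a,b,c)$ denote the number of nonnegative integers $n$ for which the equation $ax+by+cz=n$ has at most $3$ solutions in nonnegative integers $x,y,z$. Let $i\ge 3$. For every $k\ge 3$ only finitely many nonnegative integers have at most $3$ representations by $F_i,F_{i+2},F_{i+k}$, and the following formulas hold: \begin{align*} n_3(F_i,F_{i+2},F_{i+k})&=\tfrac12\bigl(7F_iF_{i+2}-F_i-F_{i+2}+1\bigr)\quad(k\ge i+3),\\ n_3(F_i,F_{i+2},F_{2i+2})&=\tfrac12\bigl((F_i+2F_{i+2}-1)F_{i+2}-F_i+1\bigr)-F_iF_{i-1},\\ n_3(F_i,F_{i+2},F_{2i+1})&=\tfrac12\bigl((5F_i-1)F_{i+2}-F_i+1\bigr)-F_{i-1}F_{i-2},\\ n_3(F_i,F_{i+2},F_{2i})&=\tfrac12\bigl((5F_i-1)F_{i+2}-F_i+1\bigr)-2F_iF_{i-2},\\ n_3(F_i,F_{i+2},F_{2i-1})&=\tfrac12\bigl((F_i+4F_{i-1}-1)F_{i+2}-F_i+1\bigr)-2F_{i-1}F_{i-3}\quad(i\ge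 4),\\ n_3(F_i,F_{i+2},F_{2i-2})&=\tfrac12\bigl((3F_i-1)F_{i+2}-F_i+1\bigr)-(8F_i-15F_{i-2})F_{i-4}\quad(i\ge 5). \end{align*} Moreover, for $k\ge 3$ put $r=\lfloor (F_i-1)/F_k\rfloor$. Then $r\ge 3$ if and only if $k\le i-3$, and in that case $$n_3(F_i,F_{i+2},F_{i+k})=\tfrac12\bigl((F_i+6F_k-1)F_{i+2}-F_i+1\bigr)-\tfrac12\bigl(2rF_i-(r+4)(r-3)F_k\bigr)F_{k-2}.$$ -/

import Mathlib

/-- The number of representations `d(n; a, b, c)` of `n` as `x * a + y * b + z * c` with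
nonnegative integers `x`, `y`, `z` (a cardinality in `ℕ∞`; it is finite when `a`, `b`, `c`
are positive). -/
noncomputable def numReps (a b c n : ℕ) : ℕ∞ :=
  Set.encard {v : ℕ × ℕ × ℕ | v.1 * a + v.2.1 * b + v.2.2 * c = n}

/-- The set of nonnegative integers that have at most `p` representations by `a`, `b`, `c`. -/
def atMostReps (p a b c : ℕ) : Set ℕ :=
  {n : ℕ | numReps a b c n ≤ (p : ℕ∞)}

/-- The `p`-Sylvester number `n_p(a, b, c)`: the number of nonnegative integers that have at most
`p` representations by `a`, `b`, `c`. (It is meaningful when `atMostReps p a b c` is finite.) -/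
noncomputable def sylvesterNumber (p a b c : ℕ) : ℕ :=
  (atMostReps p a b c).ncard

/-! Put $a=F_i$, $b=F_{i+2}$, $A=F_k$, $B=F_{k-2}$; then $F_{i+k}=Ab-Ba$ (`fib_add_add_fib_mul`).
Since $a,b$ are coprime, each $n$ is $jb+ua$ with a unique $0\le j<a$. Reducing $xa+yb+zc=n$ modulo
$a$ gives $y+zA=j+ma$ and $x=u-(mb-zB)$, so representations become pairs $(m,z)$ of weight $mb-zB\le
u$ (`numReps_eq_encard_pairs`). Hence $n$ has at most three of them iff $u$ is below the fourth
smallest weight.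

The bounds $2B\le A$ and $5a\le 2b$ make the weights increase from row to row in $m$ as far as
needed, so the fourth one is explicit in the row lengths $\lfloor(j+ma)/A\rfloor$
(`encard_pairs_le_three_iff`). Summing over $j$ gives $n_3=(a-1)(b-1)/2+\sum_j$ `fourthValue`
(`atMostReps_three_finite_and_card`). Each formula is this sum for one range of $k$, where the
floors are step functions of $j$. -/

/-! ### Residues modulo $a$ and a floor sum -/

/-- The residues `j * b % a`, `j < a`, are all the residues modulo `a`. -/
theorem image_mul_mod_range {a b : ℕ} (ha : 0 < a) (hab : Nat.Coprime a b) :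
    Set.InjOn (fun j => j * b % a) (Finset.range a : Set ℕ) ∧
      (Finset.range a).image (fun j => j * b % a) = Finset.range a := by
  have hinj : Set.InjOn (fun j => j * b % a) (Finset.range a : Set ℕ) := by
    intro x hx y hy hxy
    simp only [Finset.coe_range, Set.mem_Iio] at hx hy
    have h : x * b ≡ y * b [MOD a] := hxy
    have h' : x ≡ y [MOD a] := Nat.ModEq.cancel_right_of_coprime hab h
    exact Nat.ModEq.eq_of_lt_of_lt h' hx hy
  refine ⟨hinj, Finset.eq_of_subset_of_card_le ?_ ?_⟩
  · intro x hx
    obtain ⟨j, -, rfl⟩ := Finset.mem_image.1 hx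
    exact Finset.mem_range.2 (Nat.mod_lt _ ha)
  · rw [Finset.card_image_of_injOn hinj]

/-- Sum $jb=a\lfloor jb/a\rfloor+(jb \bmod a)$ over $j$; the remainders permute $0,\dots,a-1$. -/
theorem two_mul_sum_mul_div {a b : ℕ} (ha : 0 < a) (hab : Nat.Coprime a b) :
    2 * ∑ j ∈ Finset.range a, ((j * b / a : ℕ) : ℤ) = ((a : ℤ) - 1) * ((b : ℤ) - 1) := by
  obtain ⟨hinj, himg⟩ := image_mul_mod_range ha hab
  have h1 : ∑ j ∈ Finset.range a, ((j * b % a : ℕ) : ℤ) = ∑ j ∈ Finset.range a, (j : ℤ) := by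
    conv_rhs => rw [← himg]
    rw [Finset.sum_image hinj]
  have h2 : ∑ j ∈ Finset.range a, (j : ℤ) * b = a * ∑ j ∈ Finset.range a, ((j * b / a : ℕ) : ℤ)
      + ∑ j ∈ Finset.range a, (j : ℤ) := by
    rw [← h1, Finset.mul_sum, ← Finset.sum_add_distrib]
    refine Finset.sum_congr rfl fun j _ => ?_
    exact_mod_cast (Nat.div_add_mod (j * b) a).symm
  rw [← Finset.sum_mul] at h2
  have h3 : (∑ j ∈ Finset.range a, (j : ℤ)) * 2 = a * (a - 1) := by
    have := Finset.sum_range_id_mul_two a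
    have h : ((∑ j ∈ Finset.range a, j : ℕ) : ℤ) * 2 = a * ((a - 1 : ℕ) : ℤ) := by
      exact_mod_cast this
    rw [Nat.cast_sub ha] at h
    simpa using h
  have ha' : (a : ℤ) ≠ 0 := by exact_mod_cast ha.ne'
  refine mul_left_cancel₀ ha' ?_
  linear_combination (-2) * h2 + ((b : ℤ) - 1) * h3

/-! ### Representations as weighted pairs, and the fourth weight -/

/-- If `s` is a set of three elements of `T` on which `f` is at most `f p`, and `f` is at least
`f p` on the rest of `T`, then `f p` is the fourth smallest value of `f` on `T`. -/
theorem encard_sublevel_le_three_iff {α : Type*} [DecidableEq α] {T : Set α} {f : α → ℤ}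
    {x y z p : α} (hx : x ∈ T ∧ f x ≤ f p) (hy : y ∈ T ∧ f y ≤ f p) (hz : z ∈ T ∧ f z ≤ f p)
    (hp : p ∈ T) (hxy : x ≠ y) (hxz : x ≠ z) (hyz : y ≠ z) (hpx : p ≠ x) (hpy : p ≠ y)
    (hpz : p ≠ z) (hT : ∀ q ∈ T, f q < f p → q = x ∨ q = y ∨ q = z) (u : ℤ) :
    {q | q ∈ T ∧ f q ≤ u}.encard ≤ 3 ↔ u < f p := by
  constructor
  · intro h
    by_contra! hu
    have hsub : (({p, x, y, z} : Finset α) : Set α) ⊆ {q | q ∈ T ∧ f q ≤ u} := by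
      intro q hq
      simp only [Finset.coe_insert, Finset.coe_singleton, Set.mem_insert_iff,
        Set.mem_singleton_iff] at hq
      rcases hq with rfl | rfl | rfl | rfl
      · exact ⟨hp, hu⟩
      · exact ⟨hx.1, hx.2.trans hu⟩
      · exact ⟨hy.1, hy.2.trans hu⟩
      · exact ⟨hz.1, hz.2.trans hu⟩
    have h4 := (Set.encard_le_encard hsub).trans h
    rw [Set.encard_coe_eq_coe_finsetCard] at h4
    have hc : ({p, x, y, z} : Finset α).card = 4 := by
      rw [Finset.card_insert_of_notMem, Finset.card_insert_of_notMem,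
        Finset.card_insert_of_notMem, Finset.card_singleton] <;> simp [*]
    rw [hc] at h4
    exact absurd h4 (by decide)
  · intro hu
    have hsub : {q | q ∈ T ∧ f q ≤ u} ⊆ (({x, y, z} : Finset α) : Set α) := by
      rintro q ⟨hq, hqu⟩
      simpa using hT q hq (hqu.trans_lt hu)
    refine (Set.encard_le_encard hsub).trans ?_
    rw [Set.encard_coe_eq_coe_finsetCard]
    exact_mod_cast Finset.card_le_three

/-- Representations of `j * b + u * a` by `a`, `b` and `A * b - B * a` correspond to pairs
`(m, z)` with `z * A ≤ j + m * a` and `m * b - z * B ≤ u`. -/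
theorem numReps_eq_encard_pairs {a b c A B j n : ℕ} {u : ℤ} (hab : Nat.Coprime a b)
    (hj : j < a) (hc : c + B * a = A * b) (hn : (n : ℤ) = j * b + u * a) :
    numReps a b c n = Set.encard {q : ℕ × ℕ | q ∈ {q : ℕ × ℕ | q.2 * A ≤ j + q.1 * a} ∧
      (q.1 : ℤ) * b - q.2 * B ≤ u} := by
  have hcz : (c : ℤ) = A * b - B * a := by
    have : (c : ℤ) + B * a = A * b := by exact_mod_cast hc
    linarith
  have ha : (0 : ℤ) < a := by exact_mod_cast (Nat.zero_le j).trans_lt hj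
  symm
  unfold numReps
  refine Set.encard_congr (Set.BijOn.equiv
    (fun q : ℕ × ℕ => ((u - (q.1 * b - q.2 * B)).toNat, j + q.1 * a - q.2 * A, q.2))
    ⟨?_, ?_, ?_⟩)
  · rintro ⟨m, z⟩ ⟨h1, h2⟩
    simp only [Set.mem_ofPred_eq] at h1 h2 ⊢
    zify [h1]
    rw [Int.toNat_of_nonneg (by linarith), hcz, hn]
    ring
  · rintro ⟨m, z⟩ ⟨h1, h2⟩ ⟨m', z'⟩ ⟨h1', h2'⟩ h
    simp only [Set.mem_ofPred_eq, Prod.mk.injEq] at h1 h2 h1' h2' h ⊢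
    obtain ⟨-, h, rfl⟩ := h
    refine ⟨?_, rfl⟩
    have : m * a = m' * a := by omega
    exact Nat.eq_of_mul_eq_mul_right (by exact_mod_cast ha) this
  · rintro ⟨x, y, z⟩ h
    simp only [Set.mem_ofPred_eq] at h
    have hz : (x : ℤ) * a + y * b + z * c = n := by exact_mod_cast h
    rw [hcz, hn] at hz
    have hdvd : (a : ℤ) ∣ (y + z * A - j) * b :=
      ⟨u - x + z * B, by linear_combination hz⟩
    have hdvd' : (a : ℤ) ∣ y + z * A - j :=
      IsCoprime.dvd_of_dvd_mul_right (Nat.isCoprime_iff_coprime.2 hab) hdvd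
    obtain ⟨m, hm⟩ := hdvd'
    -- $am=y+zA-j>-a$ because $j<a$.
    have hm0 : 0 ≤ m := by
      by_contra! hneg
      have h1 : (a : ℤ) * m ≤ a * (-1) := mul_le_mul_of_nonneg_left (by linarith) ha.le
      have h2 : (0 : ℤ) ≤ y + z * A := by positivity
      have h3 : (j : ℤ) < a := by exact_mod_cast hj
      linarith
    lift m to ℕ using hm0
    have hu : u - (m * b - z * B) = x := by
      refine mul_left_cancel₀ ha.ne' ?_
      linear_combination (-1) * hz + (b : ℤ) * hm
    have hy : y + z * A = j + m * a := by
      have : (y : ℤ) + z * A = j + m * a := by linear_combination hm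
      exact_mod_cast this
    refine ⟨(m, z), ⟨?_, ?_⟩, ?_⟩
    · show z * A ≤ j + m * a
      omega
    · show (m : ℤ) * b - z * B ≤ u
      have : (0 : ℤ) ≤ x := by positivity
      linarith
    · simp only [Prod.mk.injEq, and_true]
      refine ⟨by rw [hu]; simp, by omega⟩

/-- The fourth smallest value of `m * b - z * B` over the pairs `(m, z)` of natural numbers with
`z * A ≤ j + m * a`. -/
def fourthValue (a b A B j : ℕ) : ℤ :=
  if 3 ≤ j / A then (3 - (j / A : ℕ)) * B
  else if 2 ≤ j / A + (j + a) / A then b - ((j / A : ℕ) + ((j + a) / A : ℕ) - 2) * B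
  else if 1 ≤ j / A + (j + a) / A + (j + 2 * a) / A then
    2 * b - ((j / A : ℕ) + ((j + a) / A : ℕ) + ((j + 2 * a) / A : ℕ) - 1) * B
  else 3 * b - ((j + 3 * a) / A : ℕ) * B

/-- Pairs are ordered by row $m$, and within a row by decreasing $z$. Row $m$ has
$\lfloor(j+ma)/A\rfloor+1$ pairs, so the tests in `fourthValue` find the first row at which four
pairs have accumulated. -/
theorem encard_pairs_le_three_iff {a b A B j : ℕ} (hA : 0 < A) (hj : j < a)
    (hab : 5 * a ≤ 2 * b) (hAB : 2 * B ≤ A) :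
    (∃ q : ℕ × ℕ, q.2 * A ≤ j + q.1 * a ∧ fourthValue a b A B j = (q.1 : ℤ) * b - q.2 * B) ∧
    ∀ u : ℤ, Set.encard {q : ℕ × ℕ | q ∈ {q : ℕ × ℕ | q.2 * A ≤ j + q.1 * a} ∧
      (q.1 : ℤ) * b - q.2 * B ≤ u} ≤ 3 ↔ u < fourthValue a b A B j := by
  set T : Set (ℕ × ℕ) := {q : ℕ × ℕ | q.2 * A ≤ j + q.1 * a} with hT
  set f : ℕ × ℕ → ℤ := fun q => (q.1 : ℤ) * b - q.2 * B with hf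
  have memT : ∀ m z, (m, z) ∈ T ↔ z ≤ (j + m * a) / A := fun m z =>
    (Nat.le_div_iff_mul_le hA).symm
  have hB : (0 : ℤ) ≤ B := by positivity
  have hb : (0 : ℤ) ≤ b := by positivity
  have hab' : 5 * (a : ℤ) ≤ 2 * b := by exact_mod_cast hab
  have row : ∀ m z, (m, z) ∈ T → 2 * ((z : ℤ) * B) ≤ (m + 1) * a := by
    intro m z h
    have h1 : (z : ℤ) * A ≤ j + m * a := by exact_mod_cast h
    have h2 : (z : ℤ) * (2 * B) ≤ z * A :=
      mul_le_mul_of_nonneg_left (by exact_mod_cast hAB) (by positivity)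
    have h3 : (j : ℤ) < a := by exact_mod_cast hj
    linarith
  have anti : ∀ m z z', z ≤ z' → f (m, z') ≤ f (m, z) := fun m z z' h => by
    have : (z : ℤ) * B ≤ z' * B := mul_le_mul_of_nonneg_right (by exact_mod_cast h) hB
    simp only [hf]; linarith
  -- With $m'=m+1+d$ and $m\le3$, `row` gives $2z'B\le(5+d)a\le(1+d)\cdot5a\le2(1+d)b$: the step up
  -- in rows outweighs the gain from $z'$.
  have cross : ∀ m z m' z', m ≤ 3 → m < m' → (m', z') ∈ T → f (m, z) ≤ f (m', z') := by
    intro m z m' z' hm hmm h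
    obtain ⟨d, rfl⟩ : ∃ d, m' = m + 1 + d := ⟨m' - (m + 1), by omega⟩
    have h1 := row _ _ h
    have h2 : (0 : ℤ) ≤ z * B := by positivity
    have h3 : ((1 : ℤ) + d) * (5 * a) ≤ (1 + d) * (2 * b) :=
      mul_le_mul_of_nonneg_left hab' (by positivity)
    have h4 : (m : ℤ) * a ≤ 3 * a :=
      mul_le_mul_of_nonneg_right (by exact_mod_cast hm) (by positivity)
    have h5 : (0 : ℤ) ≤ d * a := by positivity
    simp only [hf]
    push_cast at h1 ⊢
    linarith
  have le_of_lex : ∀ m z m' z', m ≤ 3 → (m', z') ∈ T → (m < m' ∨ m = m' ∧ z' ≤ z) →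
      f (m, z) ≤ f (m', z') := by
    rintro m z m' z' hm h (h1 | ⟨rfl, h1⟩)
    · exact cross m z m' z' hm h1 h
    · exact anti _ _ _ h1
  have lex_of_lt : ∀ m z m' z', m' ≤ 3 → (m, z) ∈ T → f (m, z) < f (m', z') →
      (m < m' ∨ m = m' ∧ z' < z) := by
    intro m z m' z' hm h hlt
    rcases lt_trichotomy m m' with h1 | rfl | h1
    · exact Or.inl h1
    · exact Or.inr ⟨rfl, by by_contra! h'; exact absurd (anti m z z' h') (by linarith)⟩
    · exact absurd (cross m' z' m z hm h1 h) (by linarith)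
  have z01 : j / A ≤ (j + a) / A := Nat.div_le_div_right (by omega)
  -- it suffices to point out the first four pairs
  suffices h : ∃ m₁ z₁ m₂ z₂ m₃ z₃ m z : ℕ, (m₁ ≤ 3 ∧ m₂ ≤ 3 ∧ m₃ ≤ 3 ∧ m ≤ 3) ∧
      ((m₁, z₁) ∈ T ∧ (m₂, z₂) ∈ T ∧ (m₃, z₃) ∈ T ∧ (m, z) ∈ T) ∧
      (m₁ < m ∨ m₁ = m ∧ z < z₁) ∧ (m₂ < m ∨ m₂ = m ∧ z < z₂) ∧ (m₃ < m ∨ m₃ = m ∧ z < z₃) ∧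
      (m₁ < m₂ ∨ m₁ = m₂ ∧ z₂ < z₁) ∧ (m₂ < m₃ ∨ m₂ = m₃ ∧ z₃ < z₂) ∧
      (∀ m' z', (m', z') ∈ T → (m' < m ∨ m' = m ∧ z < z') →
        m' = m₁ ∧ z' = z₁ ∨ m' = m₂ ∧ z' = z₂ ∨ m' = m₃ ∧ z' = z₃) ∧
      fourthValue a b A B j = f (m, z) by
    obtain ⟨m₁, z₁, m₂, z₂, m₃, z₃, m, z, ⟨l₁, l₂, l₃, l⟩, ⟨t₁, t₂, t₃, t⟩, e₁, e₂, e₃, d₁, d₂,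
      hrest, hval⟩ := h
    refine ⟨⟨(m, z), t, hval⟩, fun u => ?_⟩
    rw [hval]
    refine encard_sublevel_le_three_iff (x := (m₁, z₁)) (y := (m₂, z₂)) (z := (m₃, z₃))
      ⟨t₁, le_of_lex _ _ _ _ l₁ t (by omega)⟩ ⟨t₂, le_of_lex _ _ _ _ l₂ t (by omega)⟩
      ⟨t₃, le_of_lex _ _ _ _ l₃ t (by omega)⟩ t ?_ ?_ ?_ ?_ ?_ ?_ ?_ u
    iterate 6 (rw [Ne, Prod.mk.injEq]; omega)
    rintro ⟨m', z'⟩ hq hlt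
    simpa only [Prod.mk.injEq] using hrest m' z' hq (lex_of_lt _ _ _ _ l hq hlt)
  have memT0 : ∀ z, (0, z) ∈ T ↔ z ≤ j / A := fun z => by simpa using memT 0 z
  have memT1 : ∀ z, (1, z) ∈ T ↔ z ≤ (j + a) / A := fun z => by simpa using memT 1 z
  have memT2 : ∀ z, (2, z) ∈ T ↔ z ≤ (j + 2 * a) / A := memT 2
  have memT3 : ∀ z, (3, z) ∈ T ↔ z ≤ (j + 3 * a) / A := memT 3
  unfold fourthValue
  -- Only the row lengths matter from here on, which leaves linear arithmetic.
  generalize j / A = Z0 at *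
  generalize (j + a) / A = Z1 at *
  generalize (j + 2 * a) / A = Z2 at *
  generalize (j + 3 * a) / A = Z3 at *
  have rest : ∀ {m z m₁ z₁ m₂ z₂ m₃ z₃ : ℕ}, m ≤ 3 →
      (∀ w, w ≤ Z0 → (0 < m ∨ 0 = m ∧ z < w) →
        0 = m₁ ∧ w = z₁ ∨ 0 = m₂ ∧ w = z₂ ∨ 0 = m₃ ∧ w = z₃) →
      (∀ w, w ≤ Z1 → (1 < m ∨ 1 = m ∧ z < w) →
        1 = m₁ ∧ w = z₁ ∨ 1 = m₂ ∧ w = z₂ ∨ 1 = m₃ ∧ w = z₃) →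
      (∀ w, w ≤ Z2 → (2 < m ∨ 2 = m ∧ z < w) →
        2 = m₁ ∧ w = z₁ ∨ 2 = m₂ ∧ w = z₂ ∨ 2 = m₃ ∧ w = z₃) →
      (∀ w, w ≤ Z3 → (3 < m ∨ 3 = m ∧ z < w) →
        3 = m₁ ∧ w = z₁ ∨ 3 = m₂ ∧ w = z₂ ∨ 3 = m₃ ∧ w = z₃) →
      ∀ m' z', (m', z') ∈ T → (m' < m ∨ m' = m ∧ z < z') →
        m' = m₁ ∧ z' = z₁ ∨ m' = m₂ ∧ z' = z₂ ∨ m' = m₃ ∧ z' = z₃ := by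
    intro m z m₁ z₁ m₂ z₂ m₃ z₃ hm h0 h1 h2 h3 m' w ht hlt
    match m' with
    | 0 => exact h0 w ((memT0 w).1 ht) hlt
    | 1 => exact h1 w ((memT1 w).1 ht) hlt
    | 2 => exact h2 w ((memT2 w).1 ht) hlt
    | 3 => exact h3 w ((memT3 w).1 ht) hlt
    | m' + 4 => omega
  rcases le_or_gt 3 Z0 with c0 | c0
  · refine ⟨0, Z0, 0, Z0 - 1, 0, Z0 - 2, 0, Z0 - 3, by omega, ?_, by omega, by omega, by omega,
      by omega, by omega, ?_, ?_⟩
    · simp only [memT0]; omega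
    · apply rest <;> omega
    · rw [if_pos c0]; simp only [hf]; push_cast [c0]; ring
  rw [if_neg (by omega)]
  rcases le_or_gt 2 (Z0 + Z1) with c1 | c1
  · rw [if_pos c1]
    obtain rfl | rfl | rfl : Z0 = 2 ∨ Z0 = 1 ∨ Z0 = 0 := by omega
    · refine ⟨0, 2, 0, 1, 0, 0, 1, Z1, by omega, ?_, by omega, by omega, by omega,
        by omega, by omega, ?_, ?_⟩
      · simp only [memT0, memT1]; omega
      · apply rest <;> omega
      · simp only [hf]; push_cast; ring
    · refine ⟨0, 1, 0, 0, 1, Z1, 1, Z1 - 1, by omega, ?_, by omega, by omega, by omega,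
        by omega, by omega, ?_, ?_⟩
      · simp only [memT0, memT1]; omega
      · apply rest <;> omega
      · simp only [hf]; push_cast [z01]; ring
    · refine ⟨0, 0, 1, Z1, 1, Z1 - 1, 1, Z1 - 2, by omega, ?_, by omega, by omega, by omega,
        by omega, by omega, ?_, ?_⟩
      · simp only [memT0, memT1]; omega
      · apply rest <;> omega
      · simp only [hf]; push_cast [show 2 ≤ Z1 by omega]; ring
  rw [if_neg (by omega)]
  obtain rfl : Z0 = 0 := by omega
  rcases le_or_gt 1 (0 + Z1 + Z2) with c2 | c2
  · rw [if_pos c2]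
    obtain rfl | rfl : Z1 = 1 ∨ Z1 = 0 := by omega
    · refine ⟨0, 0, 1, 1, 1, 0, 2, Z2, by omega, ?_, by omega, by omega, by omega,
        by omega, by omega, ?_, ?_⟩
      · simp only [memT0, memT1, memT2]; omega
      · apply rest <;> omega
      · simp only [hf]; push_cast; ring
    · refine ⟨0, 0, 1, 0, 2, Z2, 2, Z2 - 1, by omega, ?_, by omega, by omega, by omega,
        by omega, by omega, ?_, ?_⟩
      · simp only [memT0, memT1, memT2]; omega
      · apply rest <;> omega
      · simp only [hf]; push_cast [show 1 ≤ Z2 by omega]; ring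
  · rw [if_neg (by omega)]
    obtain rfl : Z1 = 0 := by omega
    obtain rfl : Z2 = 0 := by omega
    refine ⟨0, 0, 1, 0, 2, 0, 3, Z3, by omega, ?_, by omega, by omega, by omega,
      by omega, by omega, ?_, ?_⟩
    · simp only [memT0, memT1, memT2, memT3]; omega
    · apply rest <;> omega
    · simp only [hf]; push_cast; ring

/-! ### Counting over all residue classes -/

/-- The number of nonnegative integers with at most three representations by `a`, `b` and
`A * b - B * a`, as a sum over the residues modulo `a`. -/
theorem atMostReps_three_finite_and_card {a b c A B : ℕ} (ha : 0 < a) (hcop : Nat.Coprime a b)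
    (hA : 0 < A) (hab : 5 * a ≤ 2 * b) (hAB : 2 * B ≤ A) (hc : c + B * a = A * b) :
    (atMostReps 3 a b c).Finite ∧
      (sylvesterNumber 3 a b c : ℚ) = ((a : ℚ) - 1) * ((b : ℚ) - 1) / 2 +
        ((∑ j ∈ Finset.range a, fourthValue a b A B j : ℤ) : ℚ) := by
  obtain ⟨hinj, himg⟩ := image_mul_mod_range ha hcop
  set N : ℕ → ℕ := fun j => (fourthValue a b A B j + (j * b / a : ℕ)).toNat with hN
  have key : ∀ j < a, ∀ t : ℕ, j * b % a + t * a ∈ atMostReps 3 a b c ↔ t < N j := by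
    intro j hj t
    have hn : ((j * b % a + t * a : ℕ) : ℤ) = j * b + ((t : ℤ) - (j * b / a : ℕ)) * a := by
      have h : ((a * (j * b / a) + j * b % a : ℕ) : ℤ) = j * b := by
        exact_mod_cast Nat.div_add_mod (j * b) a
      push_cast at h ⊢
      linarith
    change numReps a b c _ ≤ ((3 : ℕ) : ℕ∞) ↔ _
    rw [numReps_eq_encard_pairs hcop hj hc hn]
    refine ((encard_pairs_le_three_iff hA hj hab hAB).2 _).trans ?_
    simp only [hN]
    omega
  have hset : atMostReps 3 a b c = (((Finset.range a).sigma fun j => Finset.range (N j)).image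
      fun p : (_ : ℕ) × ℕ => p.1 * b % a + p.2 * a : Finset ℕ) := by
    ext n
    simp only [Finset.coe_image, Set.mem_image, Finset.mem_coe, Finset.mem_sigma,
      Finset.mem_range]
    constructor
    · intro h
      have hmem : n % a ∈ (Finset.range a).image (fun j => j * b % a) := by
        rw [himg]; exact Finset.mem_range.2 (Nat.mod_lt _ ha)
      obtain ⟨j, hj, hjn⟩ := Finset.mem_image.1 hmem
      have hj' := Finset.mem_range.1 hj
      have hn : j * b % a + n / a * a = n := by
        rw [hjn]; exact Nat.mod_add_div' n a
      exact ⟨⟨j, n / a⟩, ⟨hj', (key j hj' _).1 (by rwa [hn])⟩, hn⟩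
    · rintro ⟨⟨j, t⟩, ⟨hj, ht⟩, rfl⟩
      exact (key j hj t).2 ht
  -- The truncation in `N` is harmless: $a(mb-zB)=zc+b(ma-zA)\ge-jb$ for an admissible pair.
  have hNval : ∀ j < a, (N j : ℤ) = fourthValue a b A B j + (j * b / a : ℕ) := by
    intro j hj
    refine Int.toNat_of_nonneg ?_
    obtain ⟨⟨m, z⟩, h1, h2⟩ := (encard_pairs_le_three_iff (b := b) hA hj hab hAB).1
    rw [h2]
    simp only at h1 ⊢
    have h3 : ((a * (j * b / a) + j * b % a : ℕ) : ℤ) = j * b := by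
      exact_mod_cast Nat.div_add_mod (j * b) a
    have h4 : ((j * b % a : ℕ) : ℤ) < a := by exact_mod_cast Nat.mod_lt _ ha
    have h5 : (c : ℤ) + B * a = A * b := by exact_mod_cast hc
    have h6 : (z : ℤ) * A ≤ j + m * a := by exact_mod_cast h1
    have h7 : (z : ℤ) * A * b ≤ (j + m * a) * b := mul_le_mul_of_nonneg_right h6 (by positivity)
    have h8 : (0 : ℤ) ≤ z * c := by positivity
    have h9 : (z : ℤ) * (c + B * a) = z * (A * b) := by rw [h5]
    push_cast at h3 h4
    by_contra! hneg
    have h10 : (a : ℤ) * ((m * b - z * B) + ((j * b / a : ℕ) : ℤ)) ≤ a * (-1) :=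
      mul_le_mul_of_nonneg_left (by linarith) (by positivity)
    push_cast at h10
    linarith
  have hcard : sylvesterNumber 3 a b c = ∑ j ∈ Finset.range a, N j := by
    unfold sylvesterNumber
    rw [hset, Set.ncard_coe_finset, Finset.card_image_of_injOn, Finset.card_sigma]
    · simp
    · rintro ⟨j, t⟩ hp ⟨j', t'⟩ hp' h
      simp only [Finset.coe_sigma, Set.mem_sigma_iff, Finset.coe_range, Set.mem_Iio] at hp hp' h
      have hmod : j * b % a = j' * b % a := by
        have := congrArg (· % a) h
        simpa using this
      have hjj : j = j' := hinj (by simpa using hp.1) (by simpa using hp'.1) hmod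
      subst hjj
      have : t = t' := Nat.eq_of_mul_eq_mul_right ha (by omega)
      rw [this]
  refine ⟨by rw [hset]; exact Finset.finite_toSet _, ?_⟩
  have hsum : (sylvesterNumber 3 a b c : ℤ) = ∑ j ∈ Finset.range a, fourthValue a b A B j
      + ∑ j ∈ Finset.range a, ((j * b / a : ℕ) : ℤ) := by
    rw [hcard, ← Finset.sum_add_distrib]
    push_cast
    exact Finset.sum_congr rfl fun j hj => by simpa using hNval j (Finset.mem_range.1 hj)
  have h2 := two_mul_sum_mul_div ha hcop
  have h3 : ((sylvesterNumber 3 a b c : ℤ) : ℚ) = ((∑ j ∈ Finset.range a, fourthValue a b A B j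
      + ∑ j ∈ Finset.range a, ((j * b / a : ℕ) : ℤ) : ℤ) : ℚ) := by rw [hsum]
  have h4 : ((2 * ∑ j ∈ Finset.range a, ((j * b / a : ℕ) : ℤ) : ℤ) : ℚ)
      = (((a : ℤ) - 1) * ((b : ℤ) - 1) : ℤ) := by rw [h2]
  rw [Int.cast_add] at h3
  rw [Int.cast_mul] at h4
  push_cast at h3 h4 ⊢
  linarith

/-! ### Evaluating the sum of the fourth weights -/

theorem sum_range_ite_le {a t : ℕ} (h : t ≤ a) :
    ∑ j ∈ Finset.range a, (if t ≤ j then 1 else 0 : ℤ) = a - t := by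
  rw [Finset.sum_boole]
  have : (Finset.range a).filter (fun j => t ≤ j) = Finset.Ico t a := by
    ext; simp [and_comm]
  rw [this, Nat.card_Ico, Nat.cast_sub h]

/-- Both endpoints are allowed because the formulas for $r$ and $r+1$ agree at $M=(r+1)A$. -/
theorem two_mul_sum_range_div {A r M : ℕ} (hA : 0 < A) (h1 : r * A ≤ M) (h2 : M ≤ (r + 1) * A) :
    2 * ∑ j ∈ Finset.range M, ((j / A : ℕ) : ℤ) = r * (2 * M - A * (r + 1)) := by
  induction M generalizing r with
  | zero =>
    obtain rfl : r = 0 := by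
      by_contra h
      have : 0 < r * A := by positivity
      omega
    simp
  | succ M ih =>
    rw [Finset.sum_range_succ, mul_add]
    rcases Nat.lt_or_ge M (r * A) with h | h
    · obtain ⟨r, rfl⟩ : ∃ s, r = s + 1 := ⟨r - 1, by
        rcases r with _ | r
        · simp at h
        · simp⟩
      have hM : M + 1 = (r + 1) * A := by omega
      have h3 : r * A + A = (r + 1) * A := by ring
      rw [ih (r := r) (by omega) (by omega), Nat.div_eq_of_lt_le (k := r) (by omega) (by omega)]
      have hM' : (M : ℤ) + 1 = (r + 1) * A := by exact_mod_cast hM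
      push_cast
      linear_combination (-2 : ℤ) * hM'
    · rw [ih (r := r) h (by omega), Nat.div_eq_of_lt_le (k := r) h (by omega)]
      push_cast
      ring

theorem sum_fourthValue_of_four_mul_le {a b A B : ℕ} (h : 4 * a ≤ A) :
    ∑ j ∈ Finset.range a, fourthValue a b A B j = 3 * a * b := by
  have : ∀ j ∈ Finset.range a, fourthValue a b A B j = 3 * b := by
    intro j hj
    rw [Finset.mem_range] at hj
    have h0 : j / A = 0 := Nat.div_eq_of_lt (by omega)
    have h1 : (j + a) / A = 0 := Nat.div_eq_of_lt (by omega)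
    have h2 : (j + 2 * a) / A = 0 := Nat.div_eq_of_lt (by omega)
    have h3 : (j + 3 * a) / A = 0 := Nat.div_eq_of_lt (by omega)
    simp [fourthValue, h0, h1, h2, h3]
  rw [Finset.sum_congr rfl this]
  simp; ring

/-- Case $k=i+2$, $e=F_{i-1}$. The fourth pair is $(2,0)$ if $j\ge e$ and $(3,1)$ otherwise. -/
theorem sum_fourthValue_two_mul_add {a e : ℕ} (he : e ≤ a) (hea : a ≤ 2 * e) :
    ∑ j ∈ Finset.range a, fourthValue a (2 * a + e) (2 * a + e) a j
      = 2 * a * (2 * a + e) + e * (a + e) := by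
  have : ∀ j ∈ Finset.range a, fourthValue a (2 * a + e) (2 * a + e) a j
      = (5 * a + 3 * e) + (-((a : ℤ) + e)) * (if e ≤ j then 1 else 0) := by
    intro j hj
    rw [Finset.mem_range] at hj
    have h0 : j / (2 * a + e) = 0 := Nat.div_eq_of_lt (by omega)
    have h1 : (j + a) / (2 * a + e) = 0 := Nat.div_eq_of_lt (by omega)
    have h3 : (j + 3 * a) / (2 * a + e) = 1 := Nat.div_eq_of_lt_le (by omega) (by omega)
    by_cases h : e ≤ j
    · have h2 : (j + 2 * a) / (2 * a + e) = 1 := Nat.div_eq_of_lt_le (by omega) (by omega)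
      simp [fourthValue, h0, h1, h2, h]; ring
    · have h2 : (j + 2 * a) / (2 * a + e) = 0 := Nat.div_eq_of_lt (by omega)
      simp [fourthValue, h0, h1, h2, h3, h]; ring
  rw [Finset.sum_congr rfl this]
  simp only [Finset.sum_add_distrib, ← Finset.mul_sum, sum_range_ite_le he]
  simp; ring

/-- Case $k=i+1$, $e=F_{i-1}$. The fourth pair is $(2,1)$ if $j\ge e$ and $(2,0)$ otherwise. -/
theorem sum_fourthValue_add {a b e : ℕ} (he : e ≤ a) (hea : a ≤ 2 * e) :
    ∑ j ∈ Finset.range a, fourthValue a b (a + e) e j = 2 * a * b - (a - e) * e := by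
  have : ∀ j ∈ Finset.range a, fourthValue a b (a + e) e j
      = 2 * b + (-(e : ℤ)) * (if e ≤ j then 1 else 0) := by
    intro j hj
    rw [Finset.mem_range] at hj
    have h0 : j / (a + e) = 0 := Nat.div_eq_of_lt (by omega)
    have h2 : (j + 2 * a) / (a + e) = 1 := Nat.div_eq_of_lt_le (by omega) (by omega)
    by_cases h : e ≤ j
    · have h1 : (j + a) / (a + e) = 1 := Nat.div_eq_of_lt_le (by omega) (by omega)
      simp [fourthValue, h0, h1, h2, h]; ring
    · have h1 : (j + a) / (a + e) = 0 := Nat.div_eq_of_lt (by omega)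
      simp [fourthValue, h0, h1, h2, h]
  rw [Finset.sum_congr rfl this]
  simp only [Finset.sum_add_distrib, ← Finset.mul_sum, sum_range_ite_le he]
  simp; ring

/-- Case $k=i$: the fourth pair is always $(2,2)$. -/
theorem sum_fourthValue_self {a b f : ℕ} :
    ∑ j ∈ Finset.range a, fourthValue a b a f j = 2 * a * b - 2 * a * f := by
  have : ∀ j ∈ Finset.range a, fourthValue a b a f j = 2 * b - 2 * f := by
    intro j hj
    rw [Finset.mem_range] at hj
    have h0 : j / a = 0 := Nat.div_eq_of_lt (by omega)
    have h1 : (j + a) / a = 1 := Nat.div_eq_of_lt_le (by omega) (by omega)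
    have h2 : (j + 2 * a) / a = 2 := Nat.div_eq_of_lt_le (by omega) (by omega)
    simp [fourthValue, h0, h1, h2]
  rw [Finset.sum_congr rfl this]
  simp; ring

/-- Case $k=i-1$, $f=F_{i-2}$, $g=F_{i-3}$. The fourth pair is $(2,3)$ for $j<g$ and lies in row 1
afterwards. -/
theorem sum_fourthValue_two_mul_add_self {b f g : ℕ} (hg : 0 < g) (hgf : g ≤ f) :
    ∑ j ∈ Finset.range (2 * f + g), fourthValue (2 * f + g) b (f + g) g j
      = 2 * (f + g) * b - 2 * g * (f + g) := by
  have : ∀ j ∈ Finset.range (2 * f + g), fourthValue (2 * f + g) b (f + g) g j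
      = (2 * b - 3 * g) + (3 * g - b : ℤ) * (if g ≤ j then 1 else 0)
        + (-(g : ℤ)) * (if f + g ≤ j then 1 else 0)
        + (-(g : ℤ)) * (if f + 2 * g ≤ j then 1 else 0) := by
    intro j hj
    rw [Finset.mem_range] at hj
    rcases Nat.lt_or_ge j g with h | h
    · have h0 : j / (f + g) = 0 := Nat.div_eq_of_lt (by omega)
      have h1 : (j + (2 * f + g)) / (f + g) = 1 := Nat.div_eq_of_lt_le (by omega) (by omega)
      have h2 : (j + 2 * (2 * f + g)) / (f + g) = 3 :=
        Nat.div_eq_of_lt_le (by omega) (by omega)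
      simp [fourthValue, h0, h1, h2, show ¬ g ≤ j by omega, show ¬ f + g ≤ j by omega,
        show ¬ f + 2 * g ≤ j by omega]
    rcases Nat.lt_or_ge j (f + g) with h' | h'
    · have h0 : j / (f + g) = 0 := Nat.div_eq_of_lt (by omega)
      have h1 : (j + (2 * f + g)) / (f + g) = 2 := Nat.div_eq_of_lt_le (by omega) (by omega)
      simp [fourthValue, h0, h1, h, show ¬ f + g ≤ j by omega,
        show ¬ f + 2 * g ≤ j by omega]
      ring
    have h0 : j / (f + g) = 1 := Nat.div_eq_of_lt_le (by omega) (by omega)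
    rcases Nat.lt_or_ge j (f + 2 * g) with h'' | h''
    · have h1 : (j + (2 * f + g)) / (f + g) = 2 := Nat.div_eq_of_lt_le (by omega) (by omega)
      simp [fourthValue, h0, h1, h, h', show ¬ f + 2 * g ≤ j by omega]
      ring
    · have h1 : (j + (2 * f + g)) / (f + g) = 3 := Nat.div_eq_of_lt_le (by omega) (by omega)
      simp [fourthValue, h0, h1, h, h', h'']
      ring
  rw [Finset.sum_congr rfl this]
  simp only [Finset.sum_add_distrib, ← Finset.mul_sum]
  rw [sum_range_ite_le (by omega), sum_range_ite_le (by omega), sum_range_ite_le (by omega)]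
  simp; ring

/-- Case $k=i-2$, $g=F_{i-3}$, $h=F_{i-4}$. The fourth pair is always in row 1; each threshold in
$j$ is a jump of one of the first two row lengths. -/
theorem sum_fourthValue_three_mul_add {b g h : ℕ} (hg : h ≤ g) :
    ∑ j ∈ Finset.range (3 * g + 2 * h), fourthValue (3 * g + 2 * h) b (g + h) h j
      = (3 * g + 2 * h) * b - (8 * (3 * g + 2 * h) - 15 * (g + h)) * h := by
  have : ∀ j ∈ Finset.range (3 * g + 2 * h), fourthValue (3 * g + 2 * h) b (g + h) h j
      = b + (-(h : ℤ)) * (if g + h ≤ j then 1 else 0)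
        + (-(h : ℤ)) * (if 2 * g + 2 * h ≤ j then 1 else 0)
        + (-(h : ℤ)) * (if h ≤ j then 1 else 0)
        + (-(h : ℤ)) * (if g + 2 * h ≤ j then 1 else 0)
        + (-(h : ℤ)) * (if 2 * g + 3 * h ≤ j then 1 else 0) := by
    intro j hj
    rw [Finset.mem_range] at hj
    have hdiv0 : ((j / (g + h) : ℕ) : ℤ) = (if g + h ≤ j then 1 else 0)
        + (if 2 * g + 2 * h ≤ j then 1 else 0) := by
      rcases Nat.lt_or_ge j (g + h) with h1 | h1
      · rw [Nat.div_eq_of_lt h1, if_neg (by omega), if_neg (by omega)]; rfl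
      rcases Nat.lt_or_ge j (2 * g + 2 * h) with h2 | h2
      · rw [Nat.div_eq_of_lt_le (k := 1) (by omega) (by omega), if_pos h1, if_neg (by omega)]; rfl
      · rw [Nat.div_eq_of_lt_le (k := 2) (by omega) (by omega), if_pos h1, if_pos h2]; rfl
    have hdiv1 : (((j + (3 * g + 2 * h)) / (g + h) : ℕ) : ℤ) = 2 + (if h ≤ j then 1 else 0)
        + (if g + 2 * h ≤ j then 1 else 0) + (if 2 * g + 3 * h ≤ j then 1 else 0) := by
      rcases Nat.lt_or_ge j h with h1 | h1
      · rw [Nat.div_eq_of_lt_le (k := 2) (by omega) (by omega), if_neg (by omega),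
          if_neg (by omega), if_neg (by omega)]; rfl
      rcases Nat.lt_or_ge j (g + 2 * h) with h2 | h2
      · rw [Nat.div_eq_of_lt_le (k := 3) (by omega) (by omega), if_pos h1, if_neg (by omega),
          if_neg (by omega)]; rfl
      rcases Nat.lt_or_ge j (2 * g + 3 * h) with h3 | h3
      · rw [Nat.div_eq_of_lt_le (k := 4) (by omega) (by omega), if_pos h1, if_pos h2,
          if_neg (by omega)]; rfl
      · rw [Nat.div_eq_of_lt_le (k := 5) (by omega) (by omega), if_pos h1, if_pos h2,
          if_pos h3]; rfl
    have hlt : j / (g + h) < 3 := (Nat.div_lt_iff_lt_mul (by omega)).2 (by omega)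
    have hge : 2 ≤ (j + (3 * g + 2 * h)) / (g + h) :=
      (Nat.le_div_iff_mul_le (by omega)).2 (by omega)
    rw [fourthValue, if_neg (by omega), if_pos (by omega), hdiv0, hdiv1]
    ring
  rw [Finset.sum_congr rfl this]
  simp only [Finset.sum_add_distrib, ← Finset.mul_sum]
  rw [sum_range_ite_le (by omega), sum_range_ite_le (by omega), sum_range_ite_le (by omega),
    sum_range_ite_le (by omega), sum_range_ite_le (by omega)]
  simp; ring

/-- Case $k\le i-3$: row 0 alone holds four pairs once $j\ge3A$; below that, row 1 supplies the
fourth. -/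
theorem two_mul_sum_fourthValue_of_three_mul_lt {a b A B r : ℕ} (hA : 0 < A) (h3 : 3 * A ≤ a)
    (h1 : r * A ≤ a) (h2 : a ≤ (r + 1) * A) :
    2 * ∑ j ∈ Finset.range a, fourthValue a b A B j
      = 6 * A * b - (2 * r * a - (r + 4) * (r - 3) * A) * B := by
  have : ∀ j ∈ Finset.range a, fourthValue a b A B j = (3 * B + (-(B : ℤ)) * ((j / A : ℕ) : ℤ))
      + if j < 3 * A then (b - B : ℤ) + (-(B : ℤ)) * (((a + j) / A : ℕ) : ℤ) else 0 := by
    intro j hj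
    have hge : 2 ≤ (j + a) / A := (Nat.le_div_iff_mul_le hA).2 (by omega)
    rw [fourthValue]
    by_cases h : j < 3 * A
    · have hlt : j / A < 3 := (Nat.div_lt_iff_lt_mul hA).2 h
      rw [if_neg (by omega), if_pos (hge.trans (Nat.le_add_left _ _)), if_pos h, add_comm a j]
      ring
    · have hle : 3 ≤ j / A := (Nat.le_div_iff_mul_le hA).2 (by omega)
      rw [if_pos hle, if_neg h]
      ring
  rw [Finset.sum_congr rfl this, Finset.sum_add_distrib, ← Finset.sum_filter]
  have hfil : (Finset.range a).filter (fun j => j < 3 * A) = Finset.range (3 * A) := by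
    ext; simp; omega
  rw [hfil]
  simp only [Finset.sum_add_distrib, ← Finset.mul_sum]
  have e1 := two_mul_sum_range_div hA h1 h2
  -- The floors $\lfloor j/A\rfloor$ for $j<a$ and $\lfloor(a+j)/A\rfloor$ for $j<3A$ join into one
  -- sum over $[0,a+3A)$.
  have e2 := two_mul_sum_range_div (r := r + 3) (M := a + 3 * A) hA (by linarith) (by linarith)
  rw [Finset.sum_range_add] at e2
  simp only [Finset.sum_const, Finset.card_range, nsmul_eq_mul]
  push_cast at e1 e2 ⊢
  linear_combination (-(B : ℤ)) * e2

/-! ### Specialisation to Fibonacci numbers -/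

theorem fib_add_add_fib_mul (i k : ℕ) :
    Nat.fib (i + (k + 2)) + Nat.fib k * Nat.fib i = Nat.fib (k + 2) * Nat.fib (i + 2) := by
  have h1 : Nat.fib (i + (k + 2)) = Nat.fib i * Nat.fib (k + 1)
      + Nat.fib (i + 1) * Nat.fib (k + 2) := Nat.fib_add i (k + 1)
  have h2 : Nat.fib (k + 2) = Nat.fib k + Nat.fib (k + 1) := Nat.fib_add_two
  have h3 : Nat.fib (i + 2) = Nat.fib i + Nat.fib (i + 1) := Nat.fib_add_two
  rw [h1, h3, h2]
  ring

theorem coprime_fib_fib_add_two (i : ℕ) : Nat.Coprime (Nat.fib i) (Nat.fib (i + 2)) := by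
  rw [Nat.fib_add_two, Nat.coprime_self_add_right]
  exact Nat.fib_coprime_fib_succ i

theorem fib_add_three_bounds (n : ℕ) :
    0 < Nat.fib (n + 1) ∧ Nat.fib (n + 1) ≤ Nat.fib (n + 2) ∧
      Nat.fib (n + 2) ≤ 2 * Nat.fib (n + 1) := by
  have h : Nat.fib (n + 2) = Nat.fib n + Nat.fib (n + 1) := Nat.fib_add_two
  have h' : Nat.fib n ≤ Nat.fib (n + 1) := Nat.fib_le_fib_succ
  exact ⟨Nat.fib_pos.2 (by omega), by omega, by omega⟩

theorem atMostReps_three_fib {i k : ℕ} (hi : 3 ≤ i) (hk : 2 ≤ k) :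
    (atMostReps 3 (Nat.fib i) (Nat.fib (i + 2)) (Nat.fib (i + k))).Finite ∧
      (sylvesterNumber 3 (Nat.fib i) (Nat.fib (i + 2)) (Nat.fib (i + k)) : ℚ) =
        ((Nat.fib i : ℚ) - 1) * ((Nat.fib (i + 2) : ℚ) - 1) / 2 +
        ((∑ j ∈ Finset.range (Nat.fib i),
          fourthValue (Nat.fib i) (Nat.fib (i + 2)) (Nat.fib k) (Nat.fib (k - 2)) j : ℤ) : ℚ) := by
  obtain ⟨k, rfl⟩ := Nat.exists_eq_add_of_le' hk
  obtain ⟨i, rfl⟩ := Nat.exists_eq_add_of_le' hi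
  have h1 : Nat.fib (i + 3 + 2) = Nat.fib (i + 3) + Nat.fib (i + 4) := Nat.fib_add_two
  have h2 : Nat.fib (i + 4) = Nat.fib (i + 2) + Nat.fib (i + 3) := Nat.fib_add_two
  have h3 : Nat.fib (k + 2) = Nat.fib k + Nat.fib (k + 1) := Nat.fib_add_two
  have h4 : Nat.fib k ≤ Nat.fib (k + 1) := Nat.fib_le_fib_succ
  have h5 := (fib_add_three_bounds (i + 1)).2.2
  rw [Nat.add_sub_cancel]
  refine atMostReps_three_finite_and_card (Nat.fib_pos.2 (by omega)) (coprime_fib_fib_add_two _)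
    (Nat.fib_pos.2 (by omega)) ?_ (by omega) (fib_add_add_fib_mul _ _)
  simp only [show i + 1 + 2 = i + 3 by rfl, show i + 1 + 1 = i + 2 by rfl] at h5
  omega

/-- $F_{k+2}\le3F_k<F_{k+3}$. -/
theorem three_le_fib_sub_one_div_iff {i k : ℕ} (hk : 3 ≤ k) :
    3 ≤ (Nat.fib i - 1) / Nat.fib k ↔ k + 3 ≤ i := by
  have hpos : 0 < Nat.fib k := Nat.fib_pos.2 (by omega)
  obtain ⟨k, rfl⟩ := Nat.exists_eq_add_of_le' hk
  have h1 : Nat.fib (k + 3 + 2) = Nat.fib (k + 3) + Nat.fib (k + 4) := Nat.fib_add_two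
  have h2 : Nat.fib (k + 4) = Nat.fib (k + 2) + Nat.fib (k + 3) := Nat.fib_add_two
  have h3 : Nat.fib (k + 3 + 3) = Nat.fib (k + 4) + Nat.fib (k + 3 + 2) := Nat.fib_add_two
  have h4 : 0 < Nat.fib (k + 2) := Nat.fib_pos.2 (by omega)
  have h5 : Nat.fib (k + 2) ≤ Nat.fib (k + 3) := Nat.fib_le_fib_succ
  rw [Nat.le_div_iff_mul_le hpos]
  constructor
  · intro h
    by_contra! hlt
    have : Nat.fib i ≤ Nat.fib (k + 3 + 2) := Nat.fib_mono (by omega)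
    omega
  · intro h
    have : Nat.fib (k + 3 + 3) ≤ Nat.fib i := Nat.fib_mono h
    omega

theorem fib_expansions (n : ℕ) :
    Nat.fib (n + 3) = Nat.fib (n + 1) + Nat.fib (n + 2) ∧
      Nat.fib (n + 4) = Nat.fib (n + 1) + 2 * Nat.fib (n + 2) ∧
      Nat.fib (n + 5) = 2 * Nat.fib (n + 1) + 3 * Nat.fib (n + 2) ∧
      Nat.fib (n + 6) = 3 * Nat.fib (n + 1) + 5 * Nat.fib (n + 2) := by
  have h1 : Nat.fib (n + 3) = Nat.fib (n + 1) + Nat.fib (n + 2) := Nat.fib_add_two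
  have h2 : Nat.fib (n + 4) = Nat.fib (n + 2) + Nat.fib (n + 3) := Nat.fib_add_two
  have h3 : Nat.fib (n + 5) = Nat.fib (n + 3) + Nat.fib (n + 4) := Nat.fib_add_two
  have h4 : Nat.fib (n + 6) = Nat.fib (n + 4) + Nat.fib (n + 5) := Nat.fib_add_two
  omega

theorem theorem12 (i : ℕ) (hi : 3 ≤ i) :
    (∀ k : ℕ, 3 ≤ k →
      (atMostReps 3 (Nat.fib i) (Nat.fib (i + 2)) (Nat.fib (i + k))).Finite) ∧
    (∀ k : ℕ, i + 3 ≤ k →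
      (sylvesterNumber 3 (Nat.fib i) (Nat.fib (i + 2)) (Nat.fib (i + k)) : ℚ) =
        1 / 2 * (7 * (Nat.fib i : ℚ) * (Nat.fib (i + 2) : ℚ)
          - (Nat.fib i : ℚ) - (Nat.fib (i + 2) : ℚ) + 1)) ∧
    ((sylvesterNumber 3 (Nat.fib i) (Nat.fib (i + 2)) (Nat.fib (2 * i + 2)) : ℚ) =
        1 / 2 * (((Nat.fib i : ℚ) + 2 * (Nat.fib (i + 2) : ℚ) - 1) * (Nat.fib (i + 2) : ℚ)
          - (Nat.fib i : ℚ) + 1)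
        - (Nat.fib i : ℚ) * (Nat.fib (i - 1) : ℚ)) ∧
    ((sylvesterNumber 3 (Nat.fib i) (Nat.fib (i + 2)) (Nat.fib (2 * i + 1)) : ℚ) =
        1 / 2 * ((5 * (Nat.fib i : ℚ) - 1) * (Nat.fib (i + 2) : ℚ) - (Nat.fib i : ℚ) + 1)
        - (Nat.fib (i - 1) : ℚ) * (Nat.fib (i - 2) : ℚ)) ∧
    ((sylvesterNumber 3 (Nat.fib i) (Nat.fib (i + 2)) (Nat.fib (2 * i)) : ℚ) =
        1 / 2 * ((5 * (Nat.fib i : ℚ) - 1) * (Nat.fib (i + 2) : ℚ) - (Nat.fib i : ℚ) + 1)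
        - 2 * (Nat.fib i : ℚ) * (Nat.fib (i - 2) : ℚ)) ∧
    (4 ≤ i →
      (sylvesterNumber 3 (Nat.fib i) (Nat.fib (i + 2)) (Nat.fib (2 * i - 1)) : ℚ) =
        1 / 2 * (((Nat.fib i : ℚ) + 4 * (Nat.fib (i - 1) : ℚ) - 1) * (Nat.fib (i + 2) : ℚ)
          - (Nat.fib i : ℚ) + 1)
        - 2 * (Nat.fib (i - 1) : ℚ) * (Nat.fib (i - 3) : ℚ)) ∧
    (5 ≤ i →
      (sylvesterNumber 3 (Nat.fib i) (Nat.fib (i + 2)) (Nat.fib (2 * i - 2)) : ℚ) =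
        1 / 2 * ((3 * (Nat.fib i : ℚ) - 1) * (Nat.fib (i + 2) : ℚ) - (Nat.fib i : ℚ) + 1)
        - (8 * (Nat.fib i : ℚ) - 15 * (Nat.fib (i - 2) : ℚ)) * (Nat.fib (i - 4) : ℚ)) ∧
    (∀ k r : ℕ, 3 ≤ k → r = (Nat.fib i - 1) / Nat.fib k →
      (3 ≤ r ↔ k + 3 ≤ i) ∧
      (3 ≤ r →
        (sylvesterNumber 3 (Nat.fib i) (Nat.fib (i + 2)) (Nat.fib (i + k)) : ℚ) =
          1 / 2 * (((Nat.fib i : ℚ) + 6 * (Nat.fib k : ℚ) - 1) * (Nat.fib (i + 2) : ℚ)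
            - (Nat.fib i : ℚ) + 1)
          - 1 / 2 * (2 * (r : ℚ) * (Nat.fib i : ℚ)
              - ((r : ℚ) + 4) * ((r : ℚ) - 3) * (Nat.fib k : ℚ)) * (Nat.fib (k - 2) : ℚ))) := by
  refine ⟨fun k hk => (atMostReps_three_fib hi (by omega)).1, ?_, ?_, ?_, ?_, ?_, ?_, ?_⟩
  · intro k hk
    rw [(atMostReps_three_fib hi (by omega)).2, sum_fourthValue_of_four_mul_le]
    · push_cast; ring
    · refine le_trans ?_ (Nat.fib_mono hk)
      obtain ⟨n, rfl⟩ := Nat.exists_eq_add_of_le' hi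
      obtain ⟨f3, f4, f5, f6⟩ := fib_expansions n
      have h4 := (fib_add_three_bounds n).2.1
      change 4 * Nat.fib (n + 3) ≤ Nat.fib (n + 6)
      omega
  · obtain ⟨n, rfl⟩ := Nat.exists_eq_add_of_le' hi
    obtain ⟨f3, f4, f5, f6⟩ := fib_expansions n
    have h1 : Nat.fib (n + 3 + 2) = 2 * Nat.fib (n + 3) + Nat.fib (n + 2) := by
      change Nat.fib (n + 5) = _; omega
    obtain ⟨-, h2, h3⟩ := fib_add_three_bounds (n + 1)
    have h := (atMostReps_three_fib (k := n + 3 + 2) hi (by omega)).2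
    rw [Nat.add_sub_cancel, h1, sum_fourthValue_two_mul_add h2 h3] at h
    rw [show 2 * (n + 3) + 2 = n + 3 + (n + 3 + 2) by ring, h1, h, Nat.add_sub_cancel (n + 2) 1]
    push_cast; ring
  · obtain ⟨n, rfl⟩ := Nat.exists_eq_add_of_le' hi
    obtain ⟨f3, f4, f5, f6⟩ := fib_expansions n
    have h1 : Nat.fib (n + 3 + 1) = Nat.fib (n + 3) + Nat.fib (n + 2) := by
      change Nat.fib (n + 4) = _; omega
    have h4 : Nat.fib (n + 3) = Nat.fib (n + 1) + Nat.fib (n + 2) := f3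
    obtain ⟨-, h2, h3⟩ := fib_add_three_bounds (n + 1)
    have h := (atMostReps_three_fib (k := n + 3 + 1) hi (by omega)).2
    rw [show n + 3 + 1 - 2 = n + 2 by omega, h1, sum_fourthValue_add h2 h3] at h
    rw [show 2 * (n + 3) + 1 = n + 3 + (n + 3 + 1) by ring, h, Nat.add_sub_cancel (n + 2) 1,
      show n + 3 - 2 = n + 1 by omega]
    have h4' : (Nat.fib (n + 3) : ℚ) = Nat.fib (n + 1) + Nat.fib (n + 2) := by exact_mod_cast h4
    push_cast
    linear_combination (-(Nat.fib (n + 2) : ℚ)) * h4'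
  · rw [two_mul i, (atMostReps_three_fib hi (by omega)).2, sum_fourthValue_self]
    push_cast; ring
  · intro hi4
    obtain ⟨n, rfl⟩ := Nat.exists_eq_add_of_le' hi4
    obtain ⟨f3, f4, f5, f6⟩ := fib_expansions n
    have h1 : Nat.fib (n + 4) = 2 * Nat.fib (n + 2) + Nat.fib (n + 1) := by omega
    have h2 : Nat.fib (n + 3) = Nat.fib (n + 2) + Nat.fib (n + 1) := by omega
    obtain ⟨h3, h4, -⟩ := fib_add_three_bounds n
    have h := (atMostReps_three_fib (k := n + 3) hi (by omega)).2
    rw [show n + 3 - 2 = n + 1 by omega, h2, h1, sum_fourthValue_two_mul_add_self h3 h4] at h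
    rw [show 2 * (n + 4) - 1 = n + 4 + (n + 3) by omega, show n + 4 - 1 = n + 3 by omega,
      show n + 4 - 3 = n + 1 by omega, h1, h, h2]
    push_cast; ring
  · intro hi5
    obtain ⟨n, rfl⟩ := Nat.exists_eq_add_of_le' hi5
    obtain ⟨f3, f4, f5, f6⟩ := fib_expansions n
    have h1 : Nat.fib (n + 3) = Nat.fib (n + 2) + Nat.fib (n + 1) := by omega
    have h2 : Nat.fib (n + 5) = 3 * Nat.fib (n + 2) + 2 * Nat.fib (n + 1) := by omega
    obtain ⟨-, h4, -⟩ := fib_add_three_bounds n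
    have h := (atMostReps_three_fib (k := n + 3) hi (by omega)).2
    rw [show n + 3 - 2 = n + 1 by omega, h1, h2, sum_fourthValue_three_mul_add h4] at h
    rw [show 2 * (n + 5) - 2 = n + 5 + (n + 3) by omega, show n + 5 - 2 = n + 3 by omega,
      show n + 5 - 4 = n + 1 by omega, h2, h, h1]
    push_cast; ring
  · rintro k r hk rfl
    refine ⟨three_le_fib_sub_one_div_iff hk, fun hr => ?_⟩
    have hA : 0 < Nat.fib k := Nat.fib_pos.2 (by omega)
    have h3 := (Nat.le_div_iff_mul_le hA).1 hr
    have h1 := Nat.div_mul_le_self (Nat.fib i - 1) (Nat.fib k)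
    have h2 := Nat.lt_mul_div_succ (Nat.fib i - 1) hA
    rw [(atMostReps_three_fib hi (by omega)).2]
    generalize (Nat.fib i - 1) / Nat.fib k = r at *
    have h := two_mul_sum_fourthValue_of_three_mul_lt (b := Nat.fib (i + 2)) (B := Nat.fib (k - 2))
      (a := Nat.fib i) (r := r) hA (by omega) (by omega)
      (by rw [Nat.mul_comm] at h2; omega)
    have h' := congrArg (Int.cast : ℤ → ℚ) h
    rw [Int.cast_mul] at h'
    push_cast at h' ⊢
    linear_combination (1 / 2 : ℚ) * h'
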